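/- Let $p\ge 1$, and let $(a_n)_{n\ge 1}$, $(b_n)_{n\ge 1}$ be real sequences with $a_n>0$, $a_{n+p}=a_n$, $b_{n+p}=b_n$; put $a_0=a_p$. Let $p_n$ be the orthonormal polynomials given by $p_{-1}=0$, $p_0=1$, $xp_n=a_{n+1}p_{n+1}+b_{n+1}p_n+a_np_{n-1}$. Put $$A_k(z)=\frac1{a_{k+1}}\begin{pmatrix} z-b_{k+1}&-a_k\\ a_{k+1}&0\end{pmatrix},\qquad T_n=A_{n-1}\cdots A_0\quad(T_0=\mathbf 1),$$ and define $q_n$ by $T_n=\begin{pmatrix}p_n&q_{n-1}\\p_{n-1}&q_{n-2}\end{pmatrix}$ (so $q_{-2}=1$, $q_{-1}=0$). Let $\Delta=\operatorname{Tr}T_p$ and let $\alpha_1<\beta_1\le\alpha_2<\beta_2\le\dots\le\alpha_p<\beta_p$ be the solutions of $\Delta=2$ and of $\Delta=-2$, counted with multiplicity, in increasing order; the bands are the intervals $[\alpha_j,\beta_j]\subset\mathbb R$. Let $\Gamma_\pm(z)=\frac{\Delta(z)}2\pm\sqrt{\bigl(\frac{\Delta(z)}2\bigr)^2-1}$ be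 the eigenvalues of $T_p(z)$, with the sign of the root chosen so that $|\Gamma_+|\ge|\Gamma_-|$, and for $z$ off the bands let $$P_+=\frac{T_p-\Gamma_-\mathbf 1}{\Gamma_+-\Gamma_-},\qquad a(z)=(P_+(z))_{21},\qquad b(z)=(P_+(z))_{11}.$$ **Theorem 2.4.** Fix an integer $b\ge 0$ and put $j_b(z)=a(z)q_{b-2}(z)+b(z)p_{b-1}(z)$. On $\mathbb C\setminus\text{bands}$ one has $|\Gamma_+(z)|>|\Gamma_-(z)|$, the function $j_b$ is analytic, and $$\lim_{m\to\infty}\Gamma_+(z)^{-m}p_{mp+b-1}(z)=j_b(z)\qquad\text{for every } z\in\mathbb C\setminus\text{bands}.$$ Moreover, for $z_0\in\mathbb C\setminus\text{bands}$: 1. If $j_b(z_0)\ne0$, there is a neighborhood of $z_0$ in which $p_{mp+b-1}$ has no zero for all large $m$. 2. If $j_b(z_0)=0$, then the zero has a finite order $k\ge1$, and there is $\varepsilon_0>0$ such that for every $0<\varepsilon<\varepsilon_0$ and all sufficiently large $m$ (depending on $\varepsilon$) $p_{mp+b-1}$ has exactly $k$ zeros, counted with multiplicity, in $\{|z-z_0|<\varepsilon\}$.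 3. There are at most $\max(2p+2b-3,\,0)$ points of $\mathbb C\setminus\text{bands}$ at which $j_b$ vanishes. -/

import Mathlib

open Polynomial Filter Topology

namespace PeriodicJacobi

/- Throughout, `a b : ℕ → ℝ` are the Jacobi parameters.  The entries with index `n ≥ 1` are the
recursion coefficients `a_n`, `b_n`; `a 0` is the auxiliary `a_0` (equal to `a_p` for a sequence
with `a (n + p) = a n` for all `n ≥ 0`), and `b 0` is never used. -/

/-- The orthonormal polynomials, with the index shifted by one: `orthoPoly a b n` is `p_{n-1}`.
So `p_{-1} = 0`, `p_0 = 1` and `a_{n+1} p_{n+1} = (x - b_{n+1}) p_n - a_n p_{n-1}`. -/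
noncomputable def orthoPoly (a b : ℕ → ℝ) : ℕ → ℝ[X]
  | 0 => 0
  | 1 => 1
  | n + 2 => C (a (n + 1))⁻¹ *
      ((X - C (b (n + 1))) * orthoPoly a b (n + 1) - C (a n) * orthoPoly a b n)

/-- The one-step matrix `A_k(z) = a_{k+1}⁻¹ [z - b_{k+1}, -a_k; a_{k+1}, 0]`. -/
noncomputable def stepMatrix (a b : ℕ → ℝ) (k : ℕ) : Matrix (Fin 2) (Fin 2) ℝ[X] :=
  C (a (k + 1))⁻¹ • !![X - C (b (k + 1)), -C (a k); C (a (k + 1)), 0]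

/-- The transfer matrix `T_n = A_{n-1} ⋯ A_0`. -/
noncomputable def transfer (a b : ℕ → ℝ) : ℕ → Matrix (Fin 2) (Fin 2) ℝ[X]
  | 0 => 1
  | n + 1 => stepMatrix a b n * transfer a b n

/-- The polynomials of the second kind, with the index shifted by two: `secondPoly a b n` is
`q_{n-2}`, defined by `T_n = [p_n, q_{n-1}; p_{n-1}, q_{n-2}]`.
In particular `q_{-2} = 1` and `q_{-1} = 0`. -/
noncomputable def secondPoly (a b : ℕ → ℝ) (n : ℕ) : ℝ[X] := transfer a b n 1 1

/-- The discriminant `Δ = Tr T_p`. -/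
noncomputable def discr (a b : ℕ → ℝ) (p : ℕ) : ℝ[X] := (transfer a b p).trace

/-- The real solutions of `Δ(x) = 2` and of `Δ(x) = -2`, counted with multiplicity and listed in
increasing order: `α_1, β_1, α_2, β_2, …, α_p, β_p`. -/
noncomputable def bandEdges (a b : ℕ → ℝ) (p : ℕ) : List ℝ :=
  ((discr a b p - C 2).roots + (discr a b p + C 2).roots).sort (· ≤ ·)

/-- The union of the bands `[α_1, β_1], …, [α_p, β_p]`, as a subset of the complex plane. -/
def bands (a b : ℕ → ℝ) (p : ℕ) : Set ℂ :=
  {z | ∃ x : ℝ, (x : ℂ) = z ∧ ∃ j < p,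
    (bandEdges a b p).getD (2 * j) 0 ≤ x ∧ x ≤ (bandEdges a b p).getD (2 * j + 1) 0}

/-- The branch of the square root of `(Δ(z)/2)² - 1` for which `Δ(z)/2 + √` is the eigenvalue of
larger modulus. -/
noncomputable def discrRoot (a b : ℕ → ℝ) (p : ℕ) (z : ℂ) : ℂ :=
  let d : ℂ := aeval z (discr a b p) / 2
  let w : ℂ := (d ^ 2 - 1) ^ (1 / 2 : ℂ)
  if ‖d - w‖ ≤ ‖d + w‖ then w else -w

/-- `Γ_+(z)`, the eigenvalue of `T_p(z)` of larger modulus (for `z` off the bands). -/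
noncomputable def gammaPlus (a b : ℕ → ℝ) (p : ℕ) (z : ℂ) : ℂ :=
  aeval z (discr a b p) / 2 + discrRoot a b p z

/-- `Γ_-(z)`, the eigenvalue of `T_p(z)` of smaller modulus (for `z` off the bands). -/
noncomputable def gammaMinus (a b : ℕ → ℝ) (p : ℕ) (z : ℂ) : ℂ :=
  aeval z (discr a b p) / 2 - discrRoot a b p z

/-- The spectral projection `P_+ = (T_p - Γ_-) / (Γ_+ - Γ_-)` of `T_p(z)` for `Γ_+(z)`. -/
noncomputable def projPlus (a b : ℕ → ℝ) (p : ℕ) (z : ℂ) : Matrix (Fin 2) (Fin 2) ℂ :=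
  (gammaPlus a b p z - gammaMinus a b p z)⁻¹ •
    ((transfer a b p).map (fun f => aeval z f) - gammaMinus a b p z • 1)

/-- The function `a(z) = ⟨(0,1), P_+(z) (1,0)⟩`. -/
noncomputable def coeffA (a b : ℕ → ℝ) (p : ℕ) (z : ℂ) : ℂ := projPlus a b p z 1 0

/-- The function `b(z) = ⟨(1,0), P_+(z) (1,0)⟩`. -/
noncomputable def coeffB (a b : ℕ → ℝ) (p : ℕ) (z : ℂ) : ℂ := projPlus a b p z 0 0

/-- The function `j_r(z) = a(z) q_{r-2}(z) + b(z) p_{r-1}(z)`. -/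
noncomputable def jost (a b : ℕ → ℝ) (p r : ℕ) (z : ℂ) : ℂ :=
  coeffA a b p z * aeval z (secondPoly a b r) + coeffB a b p z * aeval z (orthoPoly a b r)

open Classical in
/-- The number of complex zeros of a real polynomial in the set `s`, counted with multiplicity. -/
noncomputable def zeroCount (f : ℝ[X]) (s : Set ℂ) : ℕ :=
  (f.map (algebraMap ℝ ℂ)).roots.countP (· ∈ s)

end PeriodicJacobi

/-!
Off the bands the monodromy matrix `T_p(z)` has determinant `1` and trace `Δ(z) ∉ [-2, 2]`, so that
its eigenvalues satisfy `Γ_+ Γ_- = 1` and `|Γ_-| < 1 < |Γ_+|`. That `Δ(z) ∈ [-2, 2]` forces `z` into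
the bands has two ingredients: such a `z` is real, by conservation of the Wronskian of a Floquet
solution (`im_eq_zero_of_discr_mem`); hence `Δ - 2` and `Δ + 2` split over `ℝ`, and the sign of
`Δ² - 4` is read off from the sorted list of its `2p` roots (`mem_bands_of_discr_mem`).
The sign rule for the root agrees with the holomorphic branch `d √(1 - d⁻²)` of `√(d² - 1)`, where
`d = Δ / 2` (`discrRoot_eq_sqrtBranch`), so `Γ_±` and `j_r` are holomorphic.

By periodicity `T_{mp+r} = T_r T_p^m`, and the spectral decomposition of `T_p` turns this into
`Γ_+^{-m} p_{mp+r-1} = j_r + Γ_-^{2m} (p_{r-1} - j_r)` (`gammaPlus_inv_mul_orthoPoly`). The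
convergence is therefore locally uniform. The statements about zeros of `p_{mp+r-1}` follow from
Hurwitz's theorem, proved here for polynomials times zero-free holomorphic functions by means of the
argument principle (`eventually_countP_roots_eq`).

Finally, a zero of `j_r` is a zero of the lower-left entry of `T_p` or of that of the monodromy
matrix of the sequence shifted by `r` (`orthoPoly_eq_zero_of_jost_eq_zero`). Both are polynomials
of degree `p - 1`; this bounds the number of zeros and shows that they have finite order.
-/

namespace PeriodicJacobi

variable {a b : ℕ → ℝ}

/-! ### Transfer matrices and their entries -/

lemma transfer_succ_zero (n : ℕ) (j : Fin 2) :
    transfer a b (n + 1) 0 j = C (a (n + 1))⁻¹ *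
      ((X - C (b (n + 1))) * transfer a b n 0 j - C (a n) * transfer a b n 1 j) := by
  simp only [transfer, stepMatrix, Matrix.mul_apply, Fin.sum_univ_two]
  simp
  ring

lemma transfer_succ_one (ha : ∀ n, 0 < a n) (n : ℕ) (j : Fin 2) :
    transfer a b (n + 1) 1 j = transfer a b n 0 j := by
  have h : (C (a (n + 1))⁻¹ : ℝ[X]) * C (a (n + 1)) = 1 := by
    rw [← C_mul, inv_mul_cancel₀ (ha _).ne', C_1]
  simp only [transfer, stepMatrix, Matrix.mul_apply, Fin.sum_univ_two]
  simp [h]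

lemma transfer_first_column (ha : ∀ n, 0 < a n) (n : ℕ) :
    transfer a b n 0 0 = orthoPoly a b (n + 1) ∧ transfer a b n 1 0 = orthoPoly a b n := by
  induction n with
  | zero => simp [transfer, orthoPoly]
  | succ n ih =>
    rw [transfer_succ_zero, transfer_succ_one ha, ih.1, ih.2]
    exact ⟨rfl, rfl⟩

lemma natDegree_orthoPoly (ha : ∀ n, 0 < a n) (n : ℕ) :
    (orthoPoly a b (n + 1)).natDegree = n ∧ orthoPoly a b (n + 1) ≠ 0 := by
  suffices h : ∀ n, (orthoPoly a b n).degree < n ∧ (orthoPoly a b (n + 1)).degree = n by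
    have h0 : orthoPoly a b (n + 1) ≠ 0 := by
      intro h0
      have := (h n).2
      simp [h0] at this
    exact ⟨natDegree_eq_of_degree_eq_some (h n).2, h0⟩
  intro n
  induction n with
  | zero => simp [orthoPoly]
  | succ n ih =>
    have h1 : (orthoPoly a b (n + 1)).degree < (n + 1 : ℕ) := by
      rw [ih.2]; exact_mod_cast Nat.lt_succ_self n
    refine ⟨h1, ?_⟩
    have h2 : ((X - C (b (n + 1))) * orthoPoly a b (n + 1)).degree =
        ((n + 1 : ℕ) : WithBot ℕ) := by
      rw [degree_mul, degree_X_sub_C, ih.2]; push_cast; ring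
    rw [orthoPoly, degree_C_mul (inv_ne_zero (ha _).ne'), degree_sub_eq_left_of_degree_lt, h2]
    rw [h2, degree_C_mul (ha _).ne']
    exact ih.1.trans (by exact_mod_cast Nat.lt_succ_self n)

lemma degree_transfer_second_column (ha : ∀ n, 0 < a n) (n : ℕ) :
    (transfer a b n 0 1).degree < n ∧ (transfer a b n 1 1).degree < (n + 1 : ℕ) := by
  induction n with
  | zero => simp [transfer]
  | succ n ih =>
    rw [transfer_succ_zero, transfer_succ_one ha, degree_C_mul (inv_ne_zero (ha _).ne')]
    refine ⟨(degree_sub_le _ _).trans_lt (max_lt ?_ ?_), ih.1.trans ?_⟩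
    · by_cases h : transfer a b n 0 1 = 0
      · simp only [h, mul_zero, degree_zero]; exact WithBot.bot_lt_coe _
      · rw [degree_mul, degree_X_sub_C]
        have h1 := ih.1
        rw [degree_eq_natDegree h] at h1 ⊢
        norm_cast at h1 ⊢
        lia
    · rw [degree_C_mul (ha _).ne']; exact ih.2
    · norm_cast; lia

lemma natDegree_discr (ha : ∀ n, 0 < a n) {p : ℕ} (hp : 1 ≤ p) :
    (discr a b p).natDegree = p := by
  obtain ⟨m, rfl⟩ := Nat.exists_eq_add_of_le' hp
  rw [discr, Matrix.trace_fin_two, (transfer_first_column ha _).1, transfer_succ_one ha]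
  obtain ⟨h1, h0⟩ := natDegree_orthoPoly (b := b) ha (m + 1)
  rw [natDegree_add_eq_left_of_degree_lt, h1]
  rw [degree_eq_natDegree h0, h1]
  exact (degree_transfer_second_column ha m).1.trans (by exact_mod_cast Nat.lt_succ_self m)

/-- The cocycle property of the transfer matrices. -/
lemma transfer_add (r n : ℕ) :
    transfer a b (n + r) =
      transfer (fun k => a (k + r)) (fun k => b (k + r)) n * transfer a b r := by
  induction n with
  | zero => simp [transfer]
  | succ n ih =>
    rw [show n + 1 + r = (n + r) + 1 by ring, transfer, ih, transfer, ← mul_assoc]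
    congr 2
    simp only [stepMatrix, show n + 1 + r = n + r + 1 by ring]

lemma transfer_add_period {p : ℕ} (hap : ∀ n, a (n + p) = a n) (hbp : ∀ n, b (n + p) = b n)
    (n : ℕ) : transfer a b (n + p) = transfer a b n * transfer a b p := by
  rw [transfer_add]
  simp only [hap, hbp]

lemma transfer_mul_period_add {p : ℕ} (hap : ∀ n, a (n + p) = a n)
    (hbp : ∀ n, b (n + p) = b n) (r m : ℕ) :
    transfer a b (m * p + r) = transfer a b r * transfer a b p ^ m := by
  induction m with
  | zero => simp
  | succ m ih =>
    rw [show (m + 1) * p + r = (m * p + r) + p by ring, transfer_add_period hap hbp, ih, pow_succ,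
      mul_assoc]

/-- The transfer matrix `T_n(z)` at a complex spectral parameter. -/
noncomputable def transferAt (a b : ℕ → ℝ) (z : ℂ) (n : ℕ) : Matrix (Fin 2) (Fin 2) ℂ :=
  (transfer a b n).map (fun f => aeval z f)

lemma transferAt_apply (z : ℂ) (n : ℕ) (i j : Fin 2) :
    transferAt a b z n i j = aeval z (transfer a b n i j) := rfl

lemma transferAt_eq_mapMatrix (z : ℂ) (n : ℕ) :
    transferAt a b z n = (aeval z : ℝ[X] →ₐ[ℝ] ℂ).toRingHom.mapMatrix (transfer a b n) := rfl

lemma transferAt_zero (z : ℂ) : transferAt a b z 0 = 1 := by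
  rw [transferAt_eq_mapMatrix, transfer, map_one]

lemma transferAt_succ_zero (z : ℂ) (n : ℕ) (j : Fin 2) :
    (a (n + 1) : ℂ)⁻¹ * ((z - b (n + 1)) * transferAt a b z n 0 j - a n * transferAt a b z n 1 j)
      = transferAt a b z (n + 1) 0 j := by
  simp [transferAt_apply, transfer_succ_zero]

lemma transferAt_succ_one (ha : ∀ n, 0 < a n) (z : ℂ) (n : ℕ) (j : Fin 2) :
    transferAt a b z (n + 1) 1 j = transferAt a b z n 0 j := by
  simp [transferAt_apply, transfer_succ_one ha]

lemma mul_det_transferAt (ha : ∀ n, 0 < a n) (z : ℂ) (n : ℕ) :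
    (a n : ℂ) * (transferAt a b z n).det = a 0 := by
  induction n with
  | zero => simp [transferAt_zero]
  | succ n ih =>
    have h0 : (a (n + 1) : ℂ) ≠ 0 := by exact_mod_cast (ha _).ne'
    rw [← ih, Matrix.det_fin_two, Matrix.det_fin_two, transferAt_succ_one ha,
      transferAt_succ_one ha, ← transferAt_succ_zero, ← transferAt_succ_zero]
    field_simp
    ring

lemma det_transferAt_ne_zero (ha : ∀ n, 0 < a n) (z : ℂ) (n : ℕ) :
    (transferAt a b z n).det ≠ 0 := by
  have h0 : (a 0 : ℂ) ≠ 0 := by exact_mod_cast (ha _).ne'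
  rw [← mul_det_transferAt ha z n] at h0
  exact right_ne_zero_of_mul h0

lemma det_transferAt_period (ha : ∀ n, 0 < a n) {p : ℕ} (hap : ∀ n, a (n + p) = a n) (z : ℂ) :
    (transferAt a b z p).det = 1 := by
  have h0 : (a 0 : ℂ) ≠ 0 := by exact_mod_cast (ha _).ne'
  have h := mul_det_transferAt (b := b) ha z p
  rwa [show a p = a 0 by simpa using hap 0, mul_eq_left₀ h0] at h

lemma trace_transferAt (z : ℂ) (p : ℕ) :
    (transferAt a b z p).trace = aeval z (discr a b p) := by
  simp [Matrix.trace_fin_two, transferAt_apply, discr]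

/-! ### The discriminant and the bands -/

/-- Conservation of the Wronskian (Green's formula): if `Δ(z)` lies in `[-2, 2]`, then `T_p(z)` has
an eigenvalue of modulus one. Along the corresponding Floquet solution the imaginary part of
`a_n u_n \overline{u_{n-1}}` grows by `Im z |u_n|²` at each step, yet it is periodic. -/
lemma im_eq_zero_of_discr_mem (ha : ∀ n, 0 < a n) {p : ℕ} (hp : 1 ≤ p)
    (hap : ∀ n, a (n + p) = a n) {z : ℂ} {t : ℝ} (hz : aeval z (discr a b p) = (t : ℂ))
    (h1 : -2 ≤ t) (h2 : t ≤ 2) : z.im = 0 := by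
  obtain ⟨g, hg1, hg2⟩ : ∃ g : ℂ, g * (starRingEnd ℂ) g = 1 ∧ g ^ 2 - t * g + 1 = 0 := by
    have hs : Real.sqrt (1 - t ^ 2 / 4) ^ 2 = 1 - t ^ 2 / 4 := Real.sq_sqrt (by nlinarith)
    refine ⟨⟨t / 2, Real.sqrt (1 - t ^ 2 / 4)⟩, ?_, ?_⟩
    · rw [Complex.mul_conj, Complex.normSq_mk]
      norm_cast
      nlinarith
    · apply Complex.ext
      · simp only [pow_two] at hs ⊢; simp; linarith
      · simp [pow_two]; ring
  obtain ⟨v, hv0, hv⟩ : ∃ v ≠ 0, (transferAt a b z p - g • 1).mulVec v = 0 := by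
    rw [Matrix.exists_mulVec_eq_zero_iff]
    have hd := det_transferAt_period (b := b) ha hap z
    have ht := trace_transferAt (a := a) (b := b) z p
    rw [Matrix.det_fin_two] at hd
    rw [Matrix.trace_fin_two, hz] at ht
    simp only [Matrix.det_fin_two, Matrix.sub_apply, Matrix.smul_apply, Matrix.one_apply]
    simp
    linear_combination hd - g * ht + hg2
  set u : ℕ → ℂ := fun n => transferAt a b z n 0 0 * v 0 + transferAt a b z n 0 1 * v 1 with hu
  set w : ℕ → ℂ := fun n => transferAt a b z n 1 0 * v 0 + transferAt a b z n 1 1 * v 1 with hw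
  have hu0 : u 0 = v 0 := by simp [hu, transferAt_zero]
  have hw0 : w 0 = v 1 := by simp [hw, transferAt_zero]
  have hup : u p = g * v 0 := by
    have := congrFun hv 0
    simp [Matrix.mulVec, dotProduct, Fin.sum_univ_two] at this
    simp only [hu]; linear_combination this
  have hwp : w p = g * v 1 := by
    have := congrFun hv 1
    simp [Matrix.mulVec, dotProduct, Fin.sum_univ_two] at this
    simp only [hw]; linear_combination this
  have hws : ∀ n, w (n + 1) = u n := fun n => by
    simp only [hw, hu, transferAt_succ_one ha]
  have hus : ∀ n, a (n + 1) * u (n + 1) = (z - b (n + 1)) * u n - a n * w n := fun n => by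
    have h0 : (a (n + 1) : ℂ) ≠ 0 := by exact_mod_cast (ha _).ne'
    simp only [hw, hu, ← transferAt_succ_zero]
    field_simp
    ring
  have hstep : ∀ n, a (n + 1) * (u (n + 1) * (starRingEnd ℂ) (w (n + 1))).im =
      a n * (u n * (starRingEnd ℂ) (w n)).im + z.im * Complex.normSq (u n) := fun n => by
    have h := congrArg (fun x => (x * (starRingEnd ℂ) (u n)).im) (hus n)
    rw [hws]
    simp [Complex.normSq_apply] at h ⊢
    linarith
  have hsum : ∀ n, a n * (u n * (starRingEnd ℂ) (w n)).im =
      a 0 * (v 0 * (starRingEnd ℂ) (v 1)).im +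
        z.im * ∑ k ∈ Finset.range n, Complex.normSq (u k) := by
    intro n
    induction n with
    | zero => simp [hu0, hw0]
    | succ n ih => rw [hstep, ih, Finset.sum_range_succ]; ring
  have hper := hsum p
  rw [hup, hwp, map_mul, show g * v 0 * ((starRingEnd ℂ) g * (starRingEnd ℂ) (v 1)) =
    v 0 * (starRingEnd ℂ) (v 1) by linear_combination (v 0 * (starRingEnd ℂ) (v 1)) * hg1,
    show a p = a 0 by simpa using hap 0] at hper
  have hprod : z.im * ∑ k ∈ Finset.range p, Complex.normSq (u k) = 0 := by linarith
  refine (mul_eq_zero.mp hprod).resolve_right fun h => hv0 ?_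
  rw [Finset.sum_eq_zero_iff_of_nonneg fun _ _ => Complex.normSq_nonneg _] at h
  have hz' : ∀ k < p, u k = 0 := fun k hk => by simpa using h k (Finset.mem_range.mpr hk)
  have hg0 : g ≠ 0 := by rintro rfl; simp at hg1
  obtain ⟨m, rfl⟩ := Nat.exists_eq_add_of_le' hp
  rw [hws, hz' m (Nat.lt_succ_self m)] at hwp
  ext i
  fin_cases i
  · simpa [hu0] using hz' 0 hp
  · simpa [hg0] using hwp.symm

lemma splits_of_complex_roots_real {f : ℝ[X]} (h : ∀ z : ℂ, aeval z f = 0 → z.im = 0) :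
    f.Splits := by
  refine Splits.of_splits_map_of_injective (i := algebraMap ℝ ℂ) (algebraMap ℝ ℂ).injective
    (IsAlgClosed.splits _) fun z hz => ⟨z.re, ?_⟩
  have hroot := isRoot_of_mem_roots hz
  rw [IsRoot, eval_map_algebraMap] at hroot
  exact Complex.ext (by simp) (by simp [h z hroot])

/-- A product `∏ (x - e)` over a sorted list of even length is positive unless `x` lies in one of
the intervals between the entries `2j` and `2j + 1`. -/
lemma exists_mem_Icc_of_prod_nonpos (x : ℝ) (p : ℕ) (L : List ℝ) (hL : L.length = 2 * p)
    (hs : L.Pairwise (· ≤ ·)) (h : (L.map (x - ·)).prod ≤ 0) :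
    ∃ j < p, L.getD (2 * j) 0 ≤ x ∧ x ≤ L.getD (2 * j + 1) 0 := by
  induction p generalizing L with
  | zero =>
    obtain rfl : L = [] := List.length_eq_zero_iff.mp (by simpa using hL)
    norm_num at h
  | succ p ih =>
    match L, hL with
    | e₀ :: e₁ :: L, hL =>
      by_cases hx : e₀ ≤ x ∧ x ≤ e₁
      · exact ⟨0, by lia, by simpa using hx⟩
      · have he : e₀ ≤ e₁ := by simp at hs; exact hs.1.1
        have hpos : 0 < (x - e₀) * (x - e₁) := by
          by_cases h0 : e₀ ≤ x
          · have h1 : e₁ < x := by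
              by_contra! h1
              exact hx ⟨h0, h1⟩
            exact mul_pos (by linarith) (by linarith)
          · push Not at h0
            exact mul_pos_of_neg_of_neg (by linarith) (by linarith)
        have hL' : (L.map (x - ·)).prod ≤ 0 := by
          simp only [List.map_cons, List.prod_cons, ← mul_assoc] at h
          by_contra! hc
          exact absurd h (not_le.mpr (mul_pos hpos hc))
        obtain ⟨j, hj, hj'⟩ := ih L (by simp at hL; lia) (by simp at hs; exact hs.2.2) hL'
        exact ⟨j + 1, by lia, by simpa [mul_add] using hj'⟩

/-- Off the bands, the discriminant avoids `[-2, 2]`. Both `Δ - 2` and `Δ + 2` split over the reals,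
so `Δ² - 4` is a positive multiple of `∏ (x - e)` over the `2p` band edges `e`. -/
lemma mem_bands_of_discr_mem (ha : ∀ n, 0 < a n) {p : ℕ} (hp : 1 ≤ p)
    (hap : ∀ n, a (n + p) = a n) {z : ℂ} {t : ℝ} (hz : aeval z (discr a b p) = (t : ℂ))
    (h1 : -2 ≤ t) (h2 : t ≤ 2) : z ∈ bands a b p := by
  have him := im_eq_zero_of_discr_mem ha hp hap hz h1 h2
  set D := discr a b p with hD
  have hdeg : D.natDegree = p := natDegree_discr ha hp
  have hsplit : ∀ c : ℝ, -2 ≤ c → c ≤ 2 → (D - C c).Splits := fun c hc hc' =>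
    splits_of_complex_roots_real fun w hw =>
      im_eq_zero_of_discr_mem ha hp hap (t := c) (by simpa [sub_eq_zero] using hw) hc hc'
  have hlead : ∀ c : ℝ, (D - C c).leadingCoeff = D.leadingCoeff := fun c =>
    leadingCoeff_sub_of_degree_lt (by
      refine degree_C_le.trans_lt ?_
      rw [← natDegree_pos_iff_degree_pos]; lia)
  have hplus : D + C 2 = D - C (-2) := by simp
  have hS1 := hsplit 2 (by norm_num) le_rfl
  have hS2 := hsplit (-2) le_rfl (by norm_num)
  have hD0 : D.leadingCoeff ≠ 0 := by
    rw [leadingCoeff_ne_zero]; rintro h; simp [h] at hdeg; lia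
  set x := z.re with hx
  have hzx : (x : ℂ) = z := Complex.ext (by simp [hx]) (by simp [him])
  have ht : D.eval x = t := by
    have : aeval (x : ℂ) D = (t : ℂ) := by rw [hzx]; exact hz
    have h := aeval_algebraMap_apply_eq_algebraMap_eval (A := ℂ) x D
    rw [Complex.coe_algebraMap, this] at h
    exact_mod_cast h.symm
  refine ⟨x, hzx, exists_mem_Icc_of_prod_nonpos x p _ ?_ ?_ ?_⟩
  · rw [bandEdges, Multiset.length_sort, Multiset.card_add, ← hD, hplus,
      ← hS1.natDegree_eq_card_roots, ← hS2.natDegree_eq_card_roots, natDegree_sub_C,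
      natDegree_sub_C, hdeg]
    ring
  · exact Multiset.pairwise_sort _ _
  · rw [← Multiset.prod_coe, ← Multiset.map_coe, bandEdges, Multiset.sort_eq, Multiset.map_add,
      Multiset.prod_add, ← hD, hplus]
    have e1 := hS1.eval_eq_prod_roots x
    have e2 := hS2.eval_eq_prod_roots x
    rw [hlead] at e1 e2
    simp only [eval_sub, eval_C, ht] at e1 e2
    by_contra! hc
    have := mul_pos (mul_self_pos.mpr hD0) hc
    have : (t - 2) * (t - -2) ≤ 0 := by nlinarith
    rw [e1, e2] at this
    nlinarith

/-! ### The eigenvalues of the monodromy matrix -/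

lemma one_sub_inv_sq_mem_slitPlane {d : ℂ} (hd : d ∉ Complex.ofReal '' Set.Icc (-1) 1) :
    1 - (d ^ 2)⁻¹ ∈ Complex.slitPlane := by
  by_contra h
  rw [Complex.mem_slitPlane_iff] at h
  push Not at h
  obtain ⟨hre, him⟩ := h
  set s := (1 - (d ^ 2)⁻¹).re with hs
  have hse : 1 - (d ^ 2)⁻¹ = (s : ℂ) := Complex.ext rfl him
  have hc : d ^ 2 = ((1 - s)⁻¹ : ℝ) := by
    rw [← inv_inj]; push_cast; rw [inv_inv]; linear_combination -hse
  have hpos : 0 ≤ (1 - s)⁻¹ := inv_nonneg.mpr (by linarith)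
  have hle : Real.sqrt (1 - s)⁻¹ ≤ 1 := by
    exact Real.sqrt_le_iff.mpr ⟨zero_le_one, by
      rw [one_pow]; exact inv_le_one_of_one_le₀ (by linarith)⟩
  have hsq : ((Real.sqrt (1 - s)⁻¹ : ℝ) : ℂ) ^ 2 = d ^ 2 := by
    rw [hc]; exact_mod_cast Real.sq_sqrt hpos
  have h0 := Real.sqrt_nonneg (1 - s)⁻¹
  rcases sq_eq_sq_iff_eq_or_eq_neg.mp hsq with h | h
  · exact hd ⟨_, ⟨by linarith, hle⟩, h⟩
  · exact hd ⟨-Real.sqrt (1 - s)⁻¹, ⟨by linarith, by linarith⟩, by push_cast; rw [h]; ring⟩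

lemma re_cpow_half_pos {x : ℂ} (hx : x ∈ Complex.slitPlane) : 0 < (x ^ (1 / 2 : ℂ)).re := by
  have h0 := Complex.slitPlane_ne_zero hx
  have harg := lt_of_le_of_ne (Complex.arg_le_pi x) (Complex.mem_slitPlane_iff_arg.mp hx).1
  have harg' := Complex.neg_pi_lt_arg x
  rw [Complex.cpow_def_of_ne_zero h0, Complex.exp_re]
  refine mul_pos (Real.exp_pos _) (Real.cos_pos_of_mem_Ioo ?_)
  have : (Complex.log x * (1 / 2)).im = x.arg / 2 := by
    rw [show Complex.log x * (1 / 2) = Complex.log x * ((1 / 2 : ℝ) : ℂ) by push_cast; ring,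
      Complex.im_mul_ofReal, Complex.log_im]
    ring
  rw [this]
  constructor <;> linarith

lemma cpow_half_sq (x : ℂ) : (x ^ (1 / 2 : ℂ)) ^ 2 = x := by
  simp

/-- The branch of `√(d² - 1)` that is holomorphic off `[-1, 1]` and behaves like `d` at infinity. -/
noncomputable def sqrtBranch (d : ℂ) : ℂ := d * (1 - (d ^ 2)⁻¹) ^ (1 / 2 : ℂ)

lemma ne_zero_of_notMem_segment {d : ℂ} (hd : d ∉ Complex.ofReal '' Set.Icc (-1) 1) : d ≠ 0 := by
  rintro rfl
  exact hd ⟨0, by norm_num, by simp⟩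

lemma sqrtBranch_sq {d : ℂ} (hd : d ∉ Complex.ofReal '' Set.Icc (-1) 1) :
    sqrtBranch d ^ 2 = d ^ 2 - 1 := by
  have h0 := ne_zero_of_notMem_segment hd
  rw [sqrtBranch, mul_pow, cpow_half_sq]
  field_simp

lemma norm_sub_sqrtBranch_lt {d : ℂ} (hd : d ∉ Complex.ofReal '' Set.Icc (-1) 1) :
    ‖d - sqrtBranch d‖ < ‖d + sqrtBranch d‖ := by
  have h0 := ne_zero_of_notMem_segment hd
  have hs := re_cpow_half_pos (one_sub_inv_sq_mem_slitPlane hd)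
  rw [sqrtBranch]
  set s := (1 - (d ^ 2)⁻¹) ^ (1 / 2 : ℂ)
  rw [show d - d * s = d * (1 - s) by ring, show d + d * s = d * (1 + s) by ring, norm_mul,
    norm_mul]
  refine mul_lt_mul_of_pos_left ?_ (norm_pos_iff.mpr h0)
  rw [← sq_lt_sq₀ (norm_nonneg _) (norm_nonneg _), Complex.sq_norm, Complex.sq_norm]
  simp [Complex.normSq_apply]
  nlinarith

lemma differentiableAt_sqrtBranch {d : ℂ} (hd : d ∉ Complex.ofReal '' Set.Icc (-1) 1) :
    DifferentiableAt ℂ sqrtBranch d := by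
  have h0 := ne_zero_of_notMem_segment hd
  unfold sqrtBranch
  refine differentiableAt_id.mul (DifferentiableAt.cpow ?_ (differentiableAt_const _)
    (one_sub_inv_sq_mem_slitPlane hd))
  exact (differentiableAt_const _).sub ((differentiableAt_id.pow 2).inv (pow_ne_zero 2 h0))

/-- The resolvent domain `{z | Δ(z)/2 ∉ [-1, 1]}`, which contains the complement of the bands. -/
def resolventDomain (a b : ℕ → ℝ) (p : ℕ) : Set ℂ :=
  {z | aeval z (discr a b p) / 2 ∉ Complex.ofReal '' Set.Icc (-1) 1}

lemma isOpen_resolventDomain (a b : ℕ → ℝ) (p : ℕ) : IsOpen (resolventDomain a b p) := by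
  have hc : IsClosed (Complex.ofReal '' Set.Icc (-1) 1) :=
    (isCompact_Icc.image Complex.continuous_ofReal).isClosed
  exact hc.isOpen_compl.preimage ((Polynomial.continuous_aeval _).div_const 2)

lemma mem_resolventDomain_of_notMem_bands (ha : ∀ n, 0 < a n) {p : ℕ} (hp : 1 ≤ p)
    (hap : ∀ n, a (n + p) = a n) {z : ℂ} (hz : z ∉ bands a b p) : z ∈ resolventDomain a b p := by
  rintro ⟨t, ht, h⟩
  refine hz (mem_bands_of_discr_mem ha hp hap (t := 2 * t) ?_ (by linarith [ht.1])
    (by linarith [ht.2]))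
  push_cast
  rw [h]; ring

variable {p : ℕ} {z : ℂ}

/-- Off `[-1, 1]` the choice of sign by modulus singles out the holomorphic branch. -/
lemma discrRoot_eq_sqrtBranch (hz : z ∈ resolventDomain a b p) :
    discrRoot a b p z = sqrtBranch (aeval z (discr a b p) / 2) := by
  have h1 := sqrtBranch_sq hz
  have h2 := norm_sub_sqrtBranch_lt hz
  simp only [discrRoot]
  set d : ℂ := aeval z (discr a b p) / 2
  have h3 := cpow_half_sq (d ^ 2 - 1)
  rw [← h1] at h3
  rcases sq_eq_sq_iff_eq_or_eq_neg.mp h3 with h | h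
  · rw [← h1, h, if_pos h2.le]
  · rw [← h1, h, if_neg (by simpa [← sub_eq_add_neg] using h2), neg_neg]

lemma norm_gammaMinus_lt_norm_gammaPlus (hz : z ∈ resolventDomain a b p) :
    ‖gammaMinus a b p z‖ < ‖gammaPlus a b p z‖ := by
  rw [gammaMinus, gammaPlus, discrRoot_eq_sqrtBranch hz]
  exact norm_sub_sqrtBranch_lt hz

lemma gammaPlus_mul_gammaMinus (hz : z ∈ resolventDomain a b p) :
    gammaPlus a b p z * gammaMinus a b p z = 1 := by
  rw [gammaMinus, gammaPlus, discrRoot_eq_sqrtBranch hz]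
  linear_combination -sqrtBranch_sq hz

lemma gammaPlus_add_gammaMinus :
    gammaPlus a b p z + gammaMinus a b p z = aeval z (discr a b p) := by
  rw [gammaMinus, gammaPlus]; ring

lemma gammaPlus_ne_zero (hz : z ∈ resolventDomain a b p) : gammaPlus a b p z ≠ 0 :=
  left_ne_zero_of_mul_eq_one (gammaPlus_mul_gammaMinus hz)

lemma gammaPlus_sub_gammaMinus_ne_zero (hz : z ∈ resolventDomain a b p) :
    gammaPlus a b p z - gammaMinus a b p z ≠ 0 := by
  intro h
  have := norm_gammaMinus_lt_norm_gammaPlus hz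
  rw [sub_eq_zero.mp h] at this
  exact lt_irrefl _ this

lemma norm_gammaMinus_lt_one (hz : z ∈ resolventDomain a b p) : ‖gammaMinus a b p z‖ < 1 := by
  have h1 := norm_gammaMinus_lt_norm_gammaPlus hz
  have h2 : ‖gammaPlus a b p z‖ * ‖gammaMinus a b p z‖ = 1 := by
    rw [← norm_mul, gammaPlus_mul_gammaMinus hz, norm_one]
  nlinarith [norm_nonneg (gammaMinus a b p z)]

lemma differentiableOn_discrRoot : DifferentiableOn ℂ (discrRoot a b p) (resolventDomain a b p) := by
  refine DifferentiableOn.congr (fun z hz => ?_) fun z hz => discrRoot_eq_sqrtBranch hz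
  have h := ((Polynomial.differentiable_aeval (discr a b p)).div_const (2 : ℂ)) z
  exact (DifferentiableAt.comp (g := sqrtBranch) (f := fun w => aeval w (discr a b p) / 2) z
    (differentiableAt_sqrtBranch hz) h).differentiableWithinAt

lemma differentiableOn_gammaPlus :
    DifferentiableOn ℂ (gammaPlus a b p) (resolventDomain a b p) :=
  ((Polynomial.differentiable_aeval _).div_const _).differentiableOn.add differentiableOn_discrRoot

lemma differentiableOn_gammaMinus :
    DifferentiableOn ℂ (gammaMinus a b p) (resolventDomain a b p) :=
  ((Polynomial.differentiable_aeval _).div_const _).differentiableOn.sub differentiableOn_discrRoot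

/-! ### Counting zeros of polynomials by the argument principle -/

open Classical in
lemma circleIntegral_sum_one_div_sub {c : ℂ} {ε : ℝ} (hε : 0 < ε) (s : Multiset ℂ)
    (hs : ∀ w ∈ s, w ∉ Metric.sphere c ε) :
    CircleIntegrable (fun z => (s.map fun w => 1 / (z - w)).sum) c ε ∧
    ∮ z in C(c, ε), (s.map fun w => 1 / (z - w)).sum =
      2 * Real.pi * Complex.I * (s.countP (· ∈ Metric.ball c ε) : ℂ) := by
  induction s using Multiset.induction_on with
  | empty => simp [CircleIntegrable, circleIntegral]
  | cons w s ih =>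
    obtain ⟨ih1, ih2⟩ := ih fun v hv => hs v (Multiset.mem_cons_of_mem hv)
    have hw := hs w (Multiset.mem_cons_self _ _)
    have hcont : ContinuousOn (fun z => 1 / (z - w)) (Metric.sphere c ε) := by
      refine continuousOn_const.div (continuousOn_id.sub continuousOn_const) fun z hz => ?_
      simp only [sub_ne_zero]
      rintro rfl
      exact hw hz
    have hint := hcont.circleIntegrable hε.le
    simp only [Multiset.map_cons, Multiset.sum_cons]
    refine ⟨hint.add ih1, ?_⟩
    rw [circleIntegral.integral_add hint ih1, ih2, Multiset.countP_cons]
    split_ifs with hb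
    · have := circleIntegral.integral_sub_inv_of_mem_ball hb
      simp only [one_div, this]
      push_cast
      ring
    · have hd : DifferentiableOn ℂ (fun z => 1 / (z - w)) (Metric.closedBall c ε) := by
        refine (differentiableOn_const _).div (differentiableOn_id.sub (differentiableOn_const _))
          fun z hz => ?_
        simp only [sub_ne_zero]
        rintro rfl
        rw [Metric.mem_closedBall, le_iff_lt_or_eq] at hz
        exact hz.elim hb hw
      rw [DiffContOnCl.circleIntegral_eq_zero hε.le (hd.diffContOnCl_ball le_rfl)]
      simp

lemma circleIntegral_logDeriv_eq_zero {c : ℂ} {ε : ℝ} (hε : 0 < ε) {U : Set ℂ} (hU : IsOpen U)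
    (hUε : Metric.closedBall c ε ⊆ U) {g : ℂ → ℂ} (hg : DifferentiableOn ℂ g U)
    (hg0 : ∀ z ∈ U, g z ≠ 0) :
    CircleIntegrable (logDeriv g) c ε ∧ ∮ z in C(c, ε), logDeriv g z = 0 := by
  have hd : DifferentiableOn ℂ (logDeriv g) (Metric.closedBall c ε) :=
    ((hg.deriv hU).div hg hg0).mono hUε
  exact ⟨(hd.continuousOn.mono Metric.sphere_subset_closedBall).circleIntegrable hε.le,
    DiffContOnCl.circleIntegral_eq_zero hε.le (hd.diffContOnCl_ball le_rfl)⟩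

open Classical in
/-- The argument principle for the product of a polynomial and a zero-free holomorphic function. -/
lemma circleIntegral_logDeriv_mul_polynomial {c : ℂ} {ε : ℝ} (hε : 0 < ε) {U : Set ℂ}
    (hU : IsOpen U) (hUε : Metric.closedBall c ε ⊆ U) {g : ℂ → ℂ} (hg : DifferentiableOn ℂ g U)
    (hg0 : ∀ z ∈ U, g z ≠ 0) {P : ℂ[X]} (hP : ∀ z ∈ Metric.sphere c ε, P.eval z ≠ 0) :
    ∮ z in C(c, ε), logDeriv (fun z => g z * P.eval z) z =
      2 * Real.pi * Complex.I * (P.roots.countP (· ∈ Metric.ball c ε) : ℂ) := by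
  obtain ⟨h1, h1'⟩ := circleIntegral_logDeriv_eq_zero hε hU hUε hg hg0
  obtain ⟨h2, h2'⟩ := circleIntegral_sum_one_div_sub (c := c) hε P.roots fun w hw hwc =>
    hP w hwc (isRoot_of_mem_roots hw)
  have hadd := circleIntegral.integral_add h1 h2
  rw [h1', h2', zero_add] at hadd
  rw [← hadd]
  refine circleIntegral.integral_congr hε.le fun z hz => ?_
  have hzU := hUε (Metric.sphere_subset_closedBall hz)
  have hmul := logDeriv_mul (f := g) (g := fun z => P.eval z) z (hg0 z hzU) (hP z hz)
    (hg.differentiableAt (hU.mem_nhds hzU)) P.differentiable.differentiableAt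
  refine hmul.trans ?_
  rw [logDeriv_apply (fun z => P.eval z), Polynomial.deriv,
    (IsAlgClosed.splits P).eval_derivative_div_eval_of_ne_zero (hP z hz)]

open Classical in
/-- Hurwitz's theorem for polynomials with holomorphic zero-free prefactors: near a zero of order
`k` of the limit there are eventually exactly `k` zeros. -/
theorem eventually_countP_roots_eq {U : Set ℂ} (hU : IsOpen U) {P : ℕ → ℂ[X]} {g : ℕ → ℂ → ℂ}
    {F : ℂ → ℂ} (hg : ∀ m, DifferentiableOn ℂ (g m) U) (hg0 : ∀ m, ∀ z ∈ U, g m z ≠ 0)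
    (hlim : TendstoLocallyUniformlyOn (fun m z => g m z * (P m).eval z) F atTop U)
    {z₀ : ℂ} (hz₀ : z₀ ∈ U) {k : ℕ} (hk : analyticOrderAt F z₀ = k) :
    ∃ ε₀ > 0, ∀ ε : ℝ, 0 < ε → ε < ε₀ → ∀ᶠ m : ℕ in atTop,
      (P m).roots.countP (· ∈ Metric.ball z₀ ε) = k := by
  have hfd : ∀ m, DifferentiableOn ℂ (fun z => g m z * (P m).eval z) U := fun m =>
    (hg m).mul (P m).differentiable.differentiableOn
  have hFd : DifferentiableOn ℂ F U := hlim.differentiableOn (.of_forall hfd) hU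
  have hFa : AnalyticAt ℂ F z₀ := hFd.analyticAt (hU.mem_nhds hz₀)
  obtain ⟨h, hh, hh0, hhF⟩ := hFa.analyticOrderAt_eq_natCast.mp hk
  have hev : ∀ᶠ z in 𝓝 z₀, z ∈ U ∧ AnalyticAt ℂ h z ∧ h z ≠ 0 ∧ F z = (z - z₀) ^ k • h z := by
    filter_upwards [hU.mem_nhds hz₀, hh.eventually_analyticAt,
      hh.continuousAt.eventually_ne hh0, hhF] with z e1 e2 e3 e4 using ⟨e1, e2, e3, e4⟩
  obtain ⟨ε₀, hε₀, hball⟩ := Metric.eventually_nhds_iff_ball.mp hev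
  refine ⟨ε₀, hε₀, fun ε hε hεε => ?_⟩
  have hcl : Metric.closedBall z₀ ε ⊆ Metric.ball z₀ ε₀ := Metric.closedBall_subset_ball hεε
  set V := Metric.ball z₀ ε₀ \ {z₀} with hV
  have hVo : IsOpen V := Metric.isOpen_ball.sdiff isClosed_singleton
  have hVU : V ⊆ U := fun z hz => (hball z hz.1).1
  have hSV : Metric.sphere z₀ ε ⊆ V := fun z hz =>
    ⟨hcl (Metric.sphere_subset_closedBall hz), fun h => hε.ne' (by
      rw [Set.mem_singleton_iff] at h
      simpa [h] using hz.symm)⟩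
  have hF0 : ∀ z ∈ V, F z ≠ 0 := fun z hz => by
    rw [(hball z hz.1).2.2.2]
    exact smul_ne_zero (pow_ne_zero _ (sub_ne_zero.mpr hz.2)) (hball z hz.1).2.2.1
  have hS : IsCompact (Metric.sphere z₀ ε) := isCompact_sphere _ _
  -- the limit contributes `k` to the contour integral
  have hlimint : ∮ z in C(z₀, ε), logDeriv F z = 2 * Real.pi * Complex.I * (k : ℂ) := by
    have hhd : DifferentiableOn ℂ h (Metric.ball z₀ ε₀) := fun z hz =>
      (hball z hz).2.1.differentiableAt.differentiableWithinAt
    have hmain := circleIntegral_logDeriv_mul_polynomial hε Metric.isOpen_ball hcl hhd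
      (fun z hz => (hball z hz).2.2.1) (P := (X - C z₀) ^ k) (fun z hz => by
        simpa using fun h => absurd (sub_eq_zero.mp h) (hSV hz).2)
    have hcount : ((X - C z₀) ^ k : ℂ[X]).roots.countP (· ∈ Metric.ball z₀ ε) = k := by
      rw [roots_pow, roots_X_sub_C, Multiset.countP_nsmul, ← Multiset.cons_zero,
        Multiset.countP_cons]
      simp [hε]
    rw [hcount] at hmain
    rw [← hmain]
    refine circleIntegral.integral_congr hε.le fun z hz => ?_
    refine (logDeriv_congr_nhds ?_).eq_of_nhds
    filter_upwards [Metric.isOpen_ball.mem_nhds (hSV hz).1] with w hw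
    rw [(hball w hw).2.2.2]
    simp [mul_comm]
  -- uniform convergence of the logarithmic derivatives on the circle
  have hderiv := hlim.deriv (.of_forall hfd) hU
  have hlog : TendstoUniformlyOn (fun m => logDeriv (fun z => g m z * (P m).eval z)) (logDeriv F)
      atTop (Metric.sphere z₀ ε) := by
    refine (tendstoLocallyUniformlyOn_iff_forall_isCompact hVo).mp ?_ _ hSV hS
    exact TendstoLocallyUniformlyOn.div₀ (hderiv.mono hVU) (hlim.mono hVU)
      ((hFd.deriv hU).continuousOn.mono hVU) (hFd.continuousOn.mono hVU) hF0
  have hne : ∀ᶠ m in atTop, ∀ z ∈ Metric.sphere z₀ ε, g m z * (P m).eval z ≠ 0 := by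
    have hunif := (tendstoLocallyUniformlyOn_iff_forall_isCompact hVo).mp (hlim.mono hVU) _ hSV hS
    obtain ⟨δ, hδ, hδF⟩ : ∃ δ > 0, ∀ z ∈ Metric.sphere z₀ ε, δ ≤ ‖F z‖ :=
      hS.exists_forall_le' ((hFd.continuousOn.mono hVU).mono hSV).norm
        (fun z hz => norm_pos_iff.mpr (hF0 z (hSV hz)))
    filter_upwards [Metric.tendstoUniformlyOn_iff.mp hunif δ hδ] with m hm z hz h0
    have := hm z hz
    rw [h0, dist_zero_right] at this
    exact absurd (hδF z hz) (not_le.mpr this)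
  have hint := hlog.tendsto_circleIntegral_of_continuousOn hε.le (by
    filter_upwards [hne] with m hm
    exact (((hfd m).deriv hU).continuousOn.mono (hSV.trans hVU)).div
      ((hfd m).continuousOn.mono (hSV.trans hVU)) hm)
  rw [hlimint] at hint
  have hpi : (2 * Real.pi * Complex.I : ℂ) ≠ 0 := Complex.two_pi_I_ne_zero
  have hcount : Tendsto (fun m => ((P m).roots.countP (· ∈ Metric.ball z₀ ε) : ℂ)) atTop
      (𝓝 (k : ℂ)) := by
    have h2 := hint.const_mul (2 * Real.pi * Complex.I : ℂ)⁻¹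
    rw [inv_mul_cancel_left₀ hpi] at h2
    refine h2.congr' ?_
    filter_upwards [hne] with m hm
    rw [circleIntegral_logDeriv_mul_polynomial hε hU (fun z hz => (hball z (hcl hz)).1) (hg m)
      (hg0 m) (fun z hz => right_ne_zero_of_mul (hm z hz)), inv_mul_cancel_left₀ hpi]
  filter_upwards [Metric.tendsto_nhds.mp hcount 1 one_pos] with m hm
  rw [Complex.dist_eq] at hm
  have : ‖(((((P m).roots.countP (· ∈ Metric.ball z₀ ε) : ℕ) : ℤ) - (k : ℤ) : ℤ) : ℂ)‖ < 1 := by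
    push_cast; exact hm
  rw [Complex.norm_intCast] at this
  have h3 : |((((P m).roots.countP (· ∈ Metric.ball z₀ ε) : ℕ) : ℤ) - (k : ℤ))| < 1 := by
    exact_mod_cast this
  rw [Int.abs_lt_one_iff] at h3
  lia

/-! ### Spectral decomposition of the monodromy matrix -/

lemma sub_smul_projPlus (hz : z ∈ resolventDomain a b p) :
    (gammaPlus a b p z - gammaMinus a b p z) • projPlus a b p z =
      transferAt a b z p - gammaMinus a b p z • 1 := by
  rw [projPlus, smul_inv_smul₀ (gammaPlus_sub_gammaMinus_ne_zero hz)]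
  rfl

lemma transferAt_sq (ha : ∀ n, 0 < a n) (hap : ∀ n, a (n + p) = a n) :
    transferAt a b z p * transferAt a b z p =
      (gammaPlus a b p z + gammaMinus a b p z) • transferAt a b z p - 1 := by
  have hd := det_transferAt_period (b := b) ha hap z
  have ht := trace_transferAt (a := a) (b := b) z p
  rw [← gammaPlus_add_gammaMinus, Matrix.trace_fin_two] at ht
  rw [Matrix.det_fin_two] at hd
  rw [← ht]
  ext i j
  fin_cases i <;> fin_cases j <;> simp [Matrix.mul_apply, Fin.sum_univ_two]
  · linear_combination -hd
  · ring
  · ring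
  · linear_combination -hd

lemma transferAt_mul_projPlus (ha : ∀ n, 0 < a n) (hap : ∀ n, a (n + p) = a n)
    (hz : z ∈ resolventDomain a b p) :
    transferAt a b z p * projPlus a b p z = gammaPlus a b p z • projPlus a b p z := by
  apply smul_right_injective _ (gammaPlus_sub_gammaMinus_ne_zero hz)
  simp only
  rw [← Matrix.mul_smul, smul_comm _ (gammaPlus a b p z), sub_smul_projPlus hz, mul_sub,
    transferAt_sq ha hap, smul_sub, smul_smul, gammaPlus_mul_gammaMinus hz, Matrix.mul_smul,
    mul_one]
  module

lemma transferAt_pow (ha : ∀ n, 0 < a n) (hap : ∀ n, a (n + p) = a n)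
    (hz : z ∈ resolventDomain a b p) (m : ℕ) :
    transferAt a b z p ^ m = gammaPlus a b p z ^ m • projPlus a b p z +
      gammaMinus a b p z ^ m • (1 - projPlus a b p z) := by
  induction m with
  | zero => simp
  | succ m ih =>
    have hT : transferAt a b z p = (gammaPlus a b p z - gammaMinus a b p z) • projPlus a b p z +
        gammaMinus a b p z • 1 := by rw [sub_smul_projPlus hz]; module
    have h1 := transferAt_mul_projPlus ha hap hz
    have h2 : transferAt a b z p * (1 - projPlus a b p z) =
        gammaMinus a b p z • (1 - projPlus a b p z) := by
      rw [mul_sub, h1, mul_one]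
      nth_rewrite 1 [hT]
      module
    rw [pow_succ', ih, mul_add, Matrix.mul_smul, Matrix.mul_smul, h1, h2, smul_smul, smul_smul,
      pow_succ, pow_succ]

/-- The entry `(T_r P_+)_{21}` of the projected solution is the function `j_r`. -/
lemma jost_eq_mul_apply (ha : ∀ n, 0 < a n) (r : ℕ) :
    jost a b p r z = (transferAt a b z r * projPlus a b p z) 1 0 := by
  rw [jost, Matrix.mul_apply, Fin.sum_univ_two, coeffA, coeffB, transferAt_apply,
    transferAt_apply, (transfer_first_column ha r).2, secondPoly]
  ring

lemma aeval_orthoPoly_eq (ha : ∀ n, 0 < a n) (n : ℕ) :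
    aeval z (orthoPoly a b n) = transferAt a b z n 1 0 := by
  rw [transferAt_apply, (transfer_first_column ha n).2]

lemma transferAt_mul_period_add (hap : ∀ n, a (n + p) = a n) (hbp : ∀ n, b (n + p) = b n)
    (r m : ℕ) :
    transferAt a b z (m * p + r) = transferAt a b z r * transferAt a b z p ^ m := by
  rw [transferAt_eq_mapMatrix, transfer_mul_period_add hap hbp, map_mul, map_pow]
  rfl

/-- The rescaled orthonormal polynomials differ from `j_r` by a multiple of `Γ_-^{2m}`. -/
lemma gammaPlus_inv_mul_orthoPoly (ha : ∀ n, 0 < a n) (hap : ∀ n, a (n + p) = a n)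
    (hbp : ∀ n, b (n + p) = b n) (hz : z ∈ resolventDomain a b p) (r m : ℕ) :
    (gammaPlus a b p z ^ m)⁻¹ * aeval z (orthoPoly a b (m * p + r)) = jost a b p r z +
      (gammaMinus a b p z ^ 2) ^ m * (aeval z (orthoPoly a b r) - jost a b p r z) := by
  have hG := pow_ne_zero m (gammaPlus_ne_zero hz)
  have hinv : (gammaPlus a b p z ^ m)⁻¹ = gammaMinus a b p z ^ m :=
    inv_eq_of_mul_eq_one_right (by rw [← mul_pow, gammaPlus_mul_gammaMinus hz, one_pow])
  rw [aeval_orthoPoly_eq ha, transferAt_mul_period_add hap hbp, transferAt_pow ha hap hz, mul_add,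
    Matrix.mul_smul, Matrix.mul_smul, mul_sub, mul_one, aeval_orthoPoly_eq ha r,
    jost_eq_mul_apply ha]
  simp only [Matrix.add_apply, Matrix.smul_apply, Matrix.sub_apply, smul_eq_mul]
  rw [mul_add, inv_mul_cancel_left₀ hG, hinv]
  ring

lemma sub_mul_jost (ha : ∀ n, 0 < a n) (hap : ∀ n, a (n + p) = a n)
    (hbp : ∀ n, b (n + p) = b n) (hz : z ∈ resolventDomain a b p) (r : ℕ) :
    (gammaPlus a b p z - gammaMinus a b p z) * jost a b p r z =
      aeval z (orthoPoly a b (p + r)) - gammaMinus a b p z * aeval z (orthoPoly a b r) := by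
  have h := transferAt_mul_period_add (z := z) hap hbp r 1
  rw [one_mul, pow_one] at h
  rw [jost_eq_mul_apply ha, ← smul_eq_mul, ← Matrix.smul_apply, ← Matrix.mul_smul,
    sub_smul_projPlus hz, mul_sub, ← h, Matrix.mul_smul, mul_one, aeval_orthoPoly_eq ha,
    aeval_orthoPoly_eq ha]
  rfl

lemma differentiableOn_jost (ha : ∀ n, 0 < a n) (hap : ∀ n, a (n + p) = a n)
    (hbp : ∀ n, b (n + p) = b n) (r : ℕ) :
    DifferentiableOn ℂ (jost a b p r) (resolventDomain a b p) := by
  have h : DifferentiableOn ℂ (fun z => (aeval z (orthoPoly a b (p + r)) -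
      gammaMinus a b p z * aeval z (orthoPoly a b r)) /
      (gammaPlus a b p z - gammaMinus a b p z)) (resolventDomain a b p) :=
    ((Polynomial.differentiable_aeval _).differentiableOn.sub
      (differentiableOn_gammaMinus.mul (Polynomial.differentiable_aeval _).differentiableOn)).div
      (differentiableOn_gammaPlus.sub differentiableOn_gammaMinus)
      fun z hz => gammaPlus_sub_gammaMinus_ne_zero hz
  refine h.congr fun z hz => ?_
  rw [eq_div_iff (gammaPlus_sub_gammaMinus_ne_zero hz), mul_comm]
  exact sub_mul_jost ha hap hbp hz r

lemma tendstoLocallyUniformlyOn_jost (ha : ∀ n, 0 < a n) (hap : ∀ n, a (n + p) = a n)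
    (hbp : ∀ n, b (n + p) = b n) (r : ℕ) :
    TendstoLocallyUniformlyOn
      (fun (m : ℕ) z => (gammaPlus a b p z ^ m)⁻¹ * aeval z (orthoPoly a b (m * p + r)))
      (jost a b p r) atTop (resolventDomain a b p) := by
  rw [tendstoLocallyUniformlyOn_iff_forall_isCompact (isOpen_resolventDomain a b p)]
  intro K hK hKc
  rcases K.eq_empty_or_nonempty with rfl | hne
  · exact tendstoUniformlyOn_empty
  obtain ⟨w, hw, hwmax⟩ := hKc.exists_isMaxOn hne
    ((differentiableOn_gammaMinus (a := a) (b := b) (p := p)).continuousOn.mono hK).norm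
  have hc : ContinuousOn (fun z => aeval z (orthoPoly a b r) - jost a b p r z) K :=
    (Polynomial.continuous_aeval _).continuousOn.sub
      ((differentiableOn_jost ha hap hbp r).continuousOn.mono hK)
  obtain ⟨M, hM⟩ := hKc.exists_bound_of_continuousOn hc
  set ρ := ‖gammaMinus a b p w‖ with hρ
  have hρ1 : ρ < 1 := norm_gammaMinus_lt_one (hK hw)
  have hρ2 : ρ ^ 2 < 1 := by nlinarith [norm_nonneg (gammaMinus a b p w)]
  have hlim : Tendsto (fun m : ℕ => (ρ ^ 2) ^ m * M) atTop (𝓝 0) := by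
    simpa using (tendsto_pow_atTop_nhds_zero_of_lt_one (sq_nonneg ρ) hρ2).mul_const M
  rw [Metric.tendstoUniformlyOn_iff]
  intro δ hδ
  filter_upwards [hlim.eventually_lt_const hδ] with m hm x hx
  rw [gammaPlus_inv_mul_orthoPoly ha hap hbp (hK hx), dist_self_add_right, norm_mul, norm_pow,
    norm_pow]
  refine lt_of_le_of_lt ?_ hm
  have hx1 : ‖gammaMinus a b p x‖ ≤ ρ := hwmax hx
  exact mul_le_mul (by gcongr) (hM x hx) (norm_nonneg _) (by positivity)

/-! ### The zeros of the limit function -/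

/-- If `j_r(z) = 0`, then either `(1, 0)` is an eigenvector of `T_p(z)` for `Γ_-`, or `T_r(z)` maps
the `Γ_+`-eigenvector of `T_p(z)` to a multiple of `(1, 0)`, which is then an eigenvector of the
monodromy matrix of the sequence shifted by `r`. Either way a lower-left entry vanishes. -/
lemma orthoPoly_eq_zero_of_jost_eq_zero (ha : ∀ n, 0 < a n) (hap : ∀ n, a (n + p) = a n)
    (hbp : ∀ n, b (n + p) = b n) (hz : z ∈ resolventDomain a b p) {r : ℕ}
    (hj : jost a b p r z = 0) :
    aeval z (orthoPoly a b p) = 0 ∨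
      aeval z (orthoPoly (fun k => a (k + r)) (fun k => b (k + r)) p) = 0 := by
  set P := projPlus a b p z with hP
  by_cases h10 : P 0 0 = 0 ∧ P 1 0 = 0
  · left
    have h := congrFun (congrFun (sub_smul_projPlus hz) 1) 0
    rw [Matrix.smul_apply, ← hP, h10.2] at h
    rw [aeval_orthoPoly_eq ha]
    simpa using h.symm
  · right
    set Q := transferAt a b z r * P with hQ
    have hQ1 : Q 1 0 = 0 := (jost_eq_mul_apply ha r).symm.trans hj
    have hT : transferAt (fun k => a (k + r)) (fun k => b (k + r)) z p * Q =
        gammaPlus a b p z • Q := by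
      have h1 : transferAt (fun k => a (k + r)) (fun k => b (k + r)) z p * transferAt a b z r =
          transferAt a b z r * transferAt a b z p := by
        have h := transferAt_mul_period_add (z := z) hap hbp r 1
        rw [one_mul, pow_one] at h
        rw [← h, transferAt_eq_mapMatrix, transferAt_eq_mapMatrix, transferAt_eq_mapMatrix,
          ← map_mul, ← transfer_add]
      rw [hQ, ← mul_assoc, h1, mul_assoc, transferAt_mul_projPlus ha hap hz, Matrix.mul_smul]
    have h := congrFun (congrFun hT 1) 0
    rw [Matrix.mul_apply, Fin.sum_univ_two, Matrix.smul_apply, hQ1] at h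
    have hQ0 : Q 0 0 ≠ 0 := by
      intro hQ0
      have hdet := det_transferAt_ne_zero (b := b) ha z r
      have e0 := hQ0
      have e1 := hQ1
      rw [hQ, Matrix.mul_apply, Fin.sum_univ_two] at e0 e1
      rw [Matrix.det_fin_two] at hdet
      refine h10 ⟨?_, ?_⟩
      · refine (mul_eq_zero.mp (?_ : _ * P 0 0 = 0)).resolve_left hdet
        linear_combination transferAt a b z r 1 1 * e0 - transferAt a b z r 0 1 * e1
      · refine (mul_eq_zero.mp (?_ : _ * P 1 0 = 0)).resolve_left hdet
        linear_combination transferAt a b z r 0 0 * e1 - transferAt a b z r 1 0 * e0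
    rw [aeval_orthoPoly_eq fun n => ha _]
    simpa [hQ0] using h

lemma encard_complex_zeros_orthoPoly_le (ha : ∀ n, 0 < a n) (n : ℕ) :
    {z : ℂ | aeval z (orthoPoly a b (n + 1)) = 0}.encard ≤ n := by
  obtain ⟨h1, h0⟩ := natDegree_orthoPoly (b := b) ha n
  have hset : {z : ℂ | aeval z (orthoPoly a b (n + 1)) = 0} =
      (((orthoPoly a b (n + 1)).aroots ℂ).toFinset : Set ℂ) := by
    ext z
    simp [h0]
  rw [hset, Set.encard_coe_eq_coe_finsetCard]
  have := (Multiset.toFinset_card_le _).trans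
    (card_roots' ((orthoPoly a b (n + 1)).map (algebraMap ℝ ℂ)))
  rw [natDegree_map, h1] at this
  exact_mod_cast this

/-- The zeros of `j_r` lie among those of two polynomials of degree `p - 1`. This gives at most
`2p - 2` of them, which is enough for `r ≥ 1`; for `r = 0` the two polynomials coincide. -/
lemma encard_zeros_jost_le (ha : ∀ n, 0 < a n) (hp : 1 ≤ p) (hap : ∀ n, a (n + p) = a n)
    (hbp : ∀ n, b (n + p) = b n) (r : ℕ) :
    {z | z ∈ resolventDomain a b p ∧ jost a b p r z = 0}.encard ≤
      ((2 * p + 2 * r - 3 : ℕ) : ℕ∞) := by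
  obtain ⟨n, rfl⟩ := Nat.exists_eq_add_of_le' hp
  rcases r.eq_zero_or_pos with rfl | hr
  · refine (Set.encard_le_encard fun z hz => ?_).trans
      ((encard_complex_zeros_orthoPoly_le (b := b) ha n).trans ?_)
    · simpa using orthoPoly_eq_zero_of_jost_eq_zero ha hap hbp hz.1 hz.2
    · norm_cast; lia
  · refine (Set.encard_le_encard
      (t := {z : ℂ | aeval z (orthoPoly a b (n + 1)) = 0} ∪
        {z : ℂ | aeval z (orthoPoly (fun k => a (k + r)) (fun k => b (k + r)) (n + 1)) = 0})
      fun z hz => orthoPoly_eq_zero_of_jost_eq_zero ha hap hbp hz.1 hz.2).trans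
      ((Set.encard_union_le _ _).trans ((add_le_add (encard_complex_zeros_orthoPoly_le ha n)
        (encard_complex_zeros_orthoPoly_le (fun _ => ha _) n)).trans ?_))
    norm_cast; lia

lemma analyticOrderAt_jost_ne_top (ha : ∀ n, 0 < a n) (hp : 1 ≤ p) (hap : ∀ n, a (n + p) = a n)
    (hbp : ∀ n, b (n + p) = b n) (r : ℕ) (hz : z ∈ resolventDomain a b p) :
    analyticOrderAt (jost a b p r) z ≠ ⊤ := by
  rw [Ne, analyticOrderAt_eq_top]
  intro h
  have hfin : {z | z ∈ resolventDomain a b p ∧ jost a b p r z = 0}.Finite :=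
    Set.finite_of_encard_le_coe (encard_zeros_jost_le ha hp hap hbp r)
  refine infinite_of_mem_nhds z ?_ hfin
  filter_upwards [(isOpen_resolventDomain a b p).mem_nhds hz, h] with w h1 h2 using ⟨h1, h2⟩

lemma aeval_ne_zero_of_zeroCount_eq_zero {f : ℝ[X]} (hf : f ≠ 0) {s : Set ℂ}
    (h : zeroCount f s = 0) {w : ℂ} (hw : w ∈ s) : aeval w f ≠ 0 := fun h0 => by
  classical
  rw [zeroCount, Multiset.countP_eq_zero] at h
  exact h w (mem_aroots.mpr ⟨hf, h0⟩) hw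

/-- Hurwitz's theorem applied to `Γ_+^{-m} p_{mp+r-1} → j_r`. -/
lemma eventually_zeroCount_eq (ha : ∀ n, 0 < a n) (hap : ∀ n, a (n + p) = a n)
    (hbp : ∀ n, b (n + p) = b n) (r : ℕ) (hz : z ∈ resolventDomain a b p) {k : ℕ}
    (hk : analyticOrderAt (jost a b p r) z = k) :
    ∃ ε₀ > 0, ∀ ε : ℝ, 0 < ε → ε < ε₀ → ∀ᶠ m : ℕ in atTop,
      zeroCount (orthoPoly a b (m * p + r)) (Metric.ball z ε) = k := by
  have hlim := tendstoLocallyUniformlyOn_jost ha hap hbp r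
  simp only [← eval_map_algebraMap] at hlim
  exact eventually_countP_roots_eq (isOpen_resolventDomain a b p)
    (fun m => (differentiableOn_gammaPlus.pow m).inv fun z hz =>
      pow_ne_zero m (gammaPlus_ne_zero hz))
    (fun m z hz => inv_ne_zero (pow_ne_zero m (gammaPlus_ne_zero hz))) hlim hz hk

end PeriodicJacobi

open PeriodicJacobi in
theorem theorem2p4 (p : ℕ) (hp : 1 ≤ p) (a b : ℕ → ℝ) (ha : ∀ n, 0 < a n)
    (hap : ∀ n, a (n + p) = a n) (hbp : ∀ n, b (n + p) = b n) (r : ℕ) :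
    -- off the bands `Γ_+` strictly dominates `Γ_-`, and `j_r` is analytic there
    (∀ z ∉ bands a b p, ‖gammaMinus a b p z‖ < ‖gammaPlus a b p z‖) ∧
    AnalyticOnNhd ℂ (jost a b p r) (bands a b p)ᶜ ∧
    -- `Γ_+(z)^{-m} p_{mp+r-1}(z) → j_r(z)`
    (∀ z ∉ bands a b p,
      Tendsto (fun m : ℕ => (gammaPlus a b p z ^ m)⁻¹ * aeval z (orthoPoly a b (m * p + r)))
        atTop (𝓝 (jost a b p r z))) ∧
    -- (1)
    (∀ z₀ ∉ bands a b p, jost a b p r z₀ ≠ 0 →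
      ∃ ε > 0, ∀ᶠ m : ℕ in atTop, ∀ z ∈ Metric.ball z₀ ε,
        aeval z (orthoPoly a b (m * p + r)) ≠ 0) ∧
    -- (2)
    (∀ z₀ ∉ bands a b p, jost a b p r z₀ = 0 →
      ∃ k : ℕ, 1 ≤ k ∧ analyticOrderAt (jost a b p r) z₀ = k ∧
        ∃ ε₀ > 0, ∀ ε : ℝ, 0 < ε → ε < ε₀ → ∀ᶠ m : ℕ in atTop,
          zeroCount (orthoPoly a b (m * p + r)) (Metric.ball z₀ ε) = k) ∧
    -- (3); the truncated subtraction matters only for `p = 1`, `r = 0`, where there is no zero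
    {z | z ∉ bands a b p ∧ jost a b p r z = 0}.encard ≤ ((2 * p + 2 * r - 3 : ℕ) : ℕ∞) := by
  have hres : ∀ z ∉ bands a b p, z ∈ resolventDomain a b p := fun z hz =>
    mem_resolventDomain_of_notMem_bands ha hp hap hz
  have hana := (differentiableOn_jost ha hap hbp r).analyticOnNhd (isOpen_resolventDomain a b p)
  refine ⟨fun z hz => norm_gammaMinus_lt_norm_gammaPlus (hres z hz), fun z hz => hana z (hres z hz),
    fun z hz => (tendstoLocallyUniformlyOn_jost ha hap hbp r).tendsto_at (hres z hz),
    fun z hz hj => ?_, fun z hz hj => ?_, ?_⟩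
  · have hk : analyticOrderAt (jost a b p r) z = (0 : ℕ) := by
      exact_mod_cast (hana z (hres z hz)).analyticOrderAt_eq_zero.mpr hj
    obtain ⟨ε₀, hε₀, h⟩ := eventually_zeroCount_eq ha hap hbp r (hres z hz) hk
    refine ⟨ε₀ / 2, half_pos hε₀, ?_⟩
    -- for `m ≥ 1` the index `m * p + r` is positive, so the polynomial is nonzero
    filter_upwards [h (ε₀ / 2) (half_pos hε₀) (half_lt_self hε₀), eventually_ge_atTop 1]
      with m hm hm1 w hw h0
    have hpos : 1 ≤ m * p + r := (Nat.mul_pos hm1 hp).trans_le (Nat.le_add_right _ _)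
    obtain ⟨n, hn⟩ := Nat.exists_eq_add_of_le' hpos
    rw [hn] at hm h0
    exact aeval_ne_zero_of_zeroCount_eq_zero (natDegree_orthoPoly ha n).2 hm hw h0
  · have htop := analyticOrderAt_jost_ne_top ha hp hap hbp r (hres z hz)
    obtain ⟨k, hk⟩ := ENat.ne_top_iff_exists.mp htop
    refine ⟨k, ?_, hk.symm, eventually_zeroCount_eq ha hap hbp r (hres z hz) hk.symm⟩
    have h0 := (hana z (hres z hz)).analyticOrderAt_ne_zero.mpr hj
    rw [← hk] at h0
    exact Nat.one_le_iff_ne_zero.mpr (by exact_mod_cast h0)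
  · refine (Set.encard_le_encard ?_).trans (encard_zeros_jost_le ha hp hap hbp r)
    exact fun z hz => ⟨hres z hz.1, hz.2⟩
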